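/- Let $A=(a_{i,j})$ be a real $n\times n$ matrix such that (a) $a_{i,i}>0$ for all $i$, (b) $a_{i,j}<0$ for all $i\ne j$, and (c) $\sum_j a_{i,j}>0$ for all $i$. Let $C_A:=\prod_{i=1}^n[0,a_{i,i}]$ and let $$F_A:=\overline{C_A\setminus\bigcup_{\emptyset\ne S\subseteq[n]}\Big(C_A+\sum_{i\in S}A\mathbf e_i\Big)},$$ an axis-aligned (in general non-convex) polytope in $\mathbb R^n$. An ordered partial partition (OPP) on $[n]$ is a relation $\preccurlyeq$ on $[n]$ that is transitive, weakly reflexive ($x\preccurlyeq y$ implies $x\preccurlyeq x$ and $y\preccurlyeq y$) and weakly connected ($x\preccurlyeq x$ and $y\preccurlyeq y$ imply $x\preccurlyeq y$ or $y\preccurlyeq x$). Let $\operatorname{OPP}(n)$ be the set of all of them. They correspond bijectively to tuples $(X_1,\dots,X_k)$, $k\ge 0$, of pairwise disjoint non-empty subsets of $[n]$, via $x\preccurlyeq y$ iff $x\in X_i$ and $y\in X_j$ for some $i\le j$. For $z\in[n]$ let $f_z:\operatorname{OPP}(n)\to\operatorname{OPP}(n)$ be the involution that acts on tuples as follows: if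 $X_1=\{z\}$, discard $X_1$; if $X_j=\{z\}$ with $j\ge2$, merge $X_j$ into $X_{j-1}$; if $z\in X_j\neq\{z\}$, replace $X_j$ by the two consecutive parts $X_j\setminus\{z\},\{z\}$; if $z$ lies in no part, put $\{z\}$ in front of the tuple. The flip graph has vertex set $\operatorname{OPP}(n)$, two distinct OPPs being adjacent iff they are swapped by $f_z$ for some $z\in[n]$. Vertices and edges of $F_A$ are its $0$- and $1$-dimensional faces, where the dimension of the face of a polytope $P$ whose relative interior contains $x\in P$ is the dimension of the space of directions under which the cone $\{d : x+td\in P\text{ for all small }t>0\}$ is translation invariant. Then there is a bijection between the vertices of $F_A$ and $\operatorname{OPP}(n)$, the vertex $\mathbf v$ corresponding to $\preccurlyeq$ having coordinates $v_i=\sum_{j:\,i\preccurlyeq j}a_{i,j}$ for $1\le i\le n$, such that for every $1\le i\le n$, two vertices $\mathbf v$ and $\mathbf w$ of $F_A$ are connected by an edge of $F_A$ parallel to the standard basis vector $\mathbf e_i$ if and only if the corresponding elements of $\operatorname{OPP}(n)$ are swapped by $f_i$. Moreover, this bijection is a graph isomorphism from the 1-skeleton of $F_A$ (the graph of its vertices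 and edges) onto the flip graph of $\operatorname{OPP}(n)$. -/

import Mathlib

open scoped Topology Matrix

/-- An ordered partial partition of `[n]` (indexed by `Fin n`), as a relation `≼`. -/
@[ext]
structure OPP (n : ℕ) where
  rel : Fin n → Fin n → Prop
  trans : ∀ x y z, rel x y → rel y z → rel x z
  weaklyRefl : ∀ x y, rel x y → rel x x ∧ rel y y
  weaklyConnected : ∀ x y, rel x x → rel y y → rel x y ∨ rel y x

/-- A tuple `(X₁, …, X_k)` of pairwise disjoint nonempty subsets of `[n]`. -/
@[ext]
structure OPPTuple (n : ℕ) where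
  parts : List (Finset (Fin n))
  nonempty : ∀ X ∈ parts, X.Nonempty
  disjoint : parts.Pairwise Disjoint

/-- `x ≼ y` iff `x ∈ X_i` and `y ∈ X_j` for some `i ≤ j`. -/
def partsRel {n : ℕ} (L : List (Finset (Fin n))) (x y : Fin n) : Prop :=
  ∃ i j : Fin L.length, i ≤ j ∧ x ∈ L[i] ∧ y ∈ L[j]

theorem partsRel_nil {n : ℕ} (x y : Fin n) : ¬ partsRel [] x y := by
  rintro ⟨i, _⟩
  exact i.elim0

theorem partsRel_cons {n : ℕ} (X : Finset (Fin n)) (L : List (Finset (Fin n))) (x y : Fin n) :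
    partsRel (X :: L) x y ↔ (x ∈ X ∧ (y ∈ X ∨ ∃ Y ∈ L, y ∈ Y)) ∨ partsRel L x y := by
  constructor
  · rintro ⟨⟨i, hi⟩, ⟨j, hj⟩, hij, hx, hy⟩
    rcases i with _ | i
    · left
      refine ⟨by simpa using hx, ?_⟩
      rcases j with _ | j
      · left; simpa using hy
      · right
        refine ⟨L[j]'(by simpa using hj), List.getElem_mem _, by simpa using hy⟩
    · rcases j with _ | j
      · simp at hij
      · right
        refine ⟨⟨i, by simpa using hi⟩, ⟨j, by simpa using hj⟩, ?_, by simpa using hx,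
          by simpa using hy⟩
        simpa using hij
  · rintro (⟨hx, hy | ⟨Y, hY, hy⟩⟩ | ⟨⟨i, hi⟩, ⟨j, hj⟩, hij, hx, hy⟩)
    · exact ⟨⟨0, by simp⟩, ⟨0, by simp⟩, le_refl _, by simpa using hx, by simpa using hy⟩
    · obtain ⟨j, hj, rfl⟩ := List.getElem_of_mem hY
      exact ⟨⟨0, by simp⟩, ⟨j + 1, by simpa using hj⟩, by simp, by simpa using hx,
        by simpa using hy⟩
    · exact ⟨⟨i + 1, by simpa using hi⟩, ⟨j + 1, by simpa using hj⟩, by simpa using hij,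
        by simpa using hx, by simpa using hy⟩

theorem partsRel_mem {n : ℕ} {L : List (Finset (Fin n))} {x y : Fin n} (h : partsRel L x y) :
    (∃ X ∈ L, x ∈ X) ∧ ∃ Y ∈ L, y ∈ Y := by
  obtain ⟨i, j, _, hx, hy⟩ := h
  exact ⟨⟨_, List.getElem_mem _, hx⟩, ⟨_, List.getElem_mem _, hy⟩⟩

theorem partsRel_self {n : ℕ} {L : List (Finset (Fin n))} {x : Fin n} :
    partsRel L x x ↔ ∃ X ∈ L, x ∈ X := by
  refine ⟨fun h => (partsRel_mem h).1, ?_⟩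
  rintro ⟨X, hX, hx⟩
  obtain ⟨j, hj, rfl⟩ := List.getElem_of_mem hX
  exact ⟨⟨j, hj⟩, ⟨j, hj⟩, le_refl _, hx, hx⟩

theorem partsRel_trans {n : ℕ} {L : List (Finset (Fin n))} (hL : L.Pairwise Disjoint)
    {x y z : Fin n} (h : partsRel L x y) (h' : partsRel L y z) : partsRel L x z := by
  induction L with
  | nil => exact (partsRel_nil _ _ h).elim
  | cons X L ih =>
    rw [List.pairwise_cons] at hL
    rw [partsRel_cons] at h h' ⊢
    rcases h with ⟨hx, hy⟩ | h
    · rcases h' with ⟨_, hz⟩ | h'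
      · exact Or.inl ⟨hx, hz⟩
      · exact Or.inl ⟨hx, Or.inr (partsRel_mem h').2⟩
    · rcases h' with ⟨hy, _⟩ | h'
      · obtain ⟨Y, hY, hy'⟩ := (partsRel_mem h).2
        exact (Finset.disjoint_left.1 (hL.1 Y hY) hy hy').elim
      · exact Or.inr (ih hL.2 h h')

/-- The relation of a tuple. -/
def OPPTuple.toOPP {n : ℕ} (t : OPPTuple n) : OPP n where
  rel := partsRel t.parts
  trans _ _ _ := partsRel_trans t.disjoint
  weaklyRefl _ _ h := ⟨partsRel_self.2 (partsRel_mem h).1, partsRel_self.2 (partsRel_mem h).2⟩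
  weaklyConnected x y hx hy := by
    obtain ⟨i, _, _, hx, _⟩ := hx
    obtain ⟨j, _, _, hy, _⟩ := hy
    rcases le_total i j with h | h
    · exact Or.inl ⟨i, j, h, hx, hy⟩
    · exact Or.inr ⟨j, i, h, hy, hx⟩

theorem parts_eq_of_partsRel {n : ℕ} {L L' : List (Finset (Fin n))}
    (hL : ∀ X ∈ L, X.Nonempty) (hL' : ∀ X ∈ L', X.Nonempty)
    (dL : L.Pairwise Disjoint) (dL' : L'.Pairwise Disjoint)
    (h : ∀ x y, partsRel L x y ↔ partsRel L' x y) : L = L' := by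
  have first : ∀ (X : Finset (Fin n)) (M : List (Finset (Fin n))),
      (∀ Y ∈ X :: M, Y.Nonempty) → (X :: M).Pairwise Disjoint →
      ∀ x, x ∈ X ↔ partsRel (X :: M) x x ∧
        ∀ y, partsRel (X :: M) y y → partsRel (X :: M) x y := by
    intro X M hne hd x
    rw [List.pairwise_cons] at hd
    constructor
    · intro hx
      refine ⟨partsRel_self.2 ⟨X, by simp, hx⟩, fun y hy => ?_⟩
      rw [partsRel_self] at hy
      rw [partsRel_cons]
      left
      simpa [hx] using hy
    · rintro ⟨-, h2⟩
      obtain ⟨y, hy⟩ := hne X (by simp)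
      have := h2 y (partsRel_self.2 ⟨X, by simp, hy⟩)
      rw [partsRel_cons] at this
      rcases this with ⟨hx, _⟩ | h3
      · exact hx
      · obtain ⟨Y, hY, hy'⟩ := (partsRel_mem h3).2
        exact (Finset.disjoint_left.1 (hd.1 Y hY) hy hy').elim
  have rest : ∀ (X : Finset (Fin n)) (M : List (Finset (Fin n))),
      (X :: M).Pairwise Disjoint →
      ∀ x y, partsRel M x y ↔ x ∉ X ∧ partsRel (X :: M) x y := by
    intro X M hd x y
    rw [List.pairwise_cons] at hd
    rw [partsRel_cons]
    constructor
    · intro h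
      obtain ⟨Y, hY, hx⟩ := (partsRel_mem h).1
      exact ⟨fun hx' => Finset.disjoint_left.1 (hd.1 Y hY) hx' hx, Or.inr h⟩
    · rintro ⟨h1, h2 | h2⟩
      · exact (h1 h2.1).elim
      · exact h2
  induction L generalizing L' with
  | nil =>
    rcases L' with _ | ⟨X, M⟩
    · rfl
    · obtain ⟨x, hx⟩ := hL' X (by simp)
      exact (partsRel_nil _ _ ((h x x).2 (partsRel_self.2 ⟨X, by simp, hx⟩))).elim
  | cons X M ih =>
    rcases L' with _ | ⟨X', M'⟩
    · obtain ⟨x, hx⟩ := hL X (by simp)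
      exact (partsRel_nil _ _ ((h x x).1 (partsRel_self.2 ⟨X, by simp, hx⟩))).elim
    · have hX : X = X' := by
        ext x
        rw [first X M hL dL x, first X' M' hL' dL' x]
        simp only [h]
      subst hX
      have hM : M = M' := by
        refine ih (fun Y hY => hL Y (by simp [hY])) (fun Y hY => hL' Y (by simp [hY]))
          (List.pairwise_cons.1 dL).2 (List.pairwise_cons.1 dL').2 fun x y => ?_
        rw [rest X M dL, rest X M' dL', h]
      rw [hM]

theorem OPP.exists_tuple {n : ℕ} (p : OPP n) : ∃ t : OPPTuple n, t.toOPP = p := by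
  classical
  suffices H : ∀ (k : ℕ) (p : OPP n), (Finset.univ.filter fun x => p.rel x x).card = k →
      ∃ t : OPPTuple n, t.toOPP = p from H _ p rfl
  intro k
  induction k using Nat.strong_induction_on with
  | _ k ih =>
  intro p hk
  by_cases hne : (Finset.univ.filter fun x => p.rel x x).Nonempty
  · let X : Finset (Fin n) :=
      Finset.univ.filter fun x => p.rel x x ∧ ∀ y, p.rel y y → p.rel x y
    have memX : ∀ x, x ∈ X ↔ p.rel x x ∧ ∀ y, p.rel y y → p.rel x y := by
      intro x; simp [X]
    have hX : X.Nonempty := by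
      have key : ∀ s : Finset (Fin n), s.Nonempty → (∀ x ∈ s, p.rel x x) →
          ∃ x ∈ s, ∀ y ∈ s, p.rel x y := by
        intro s hs
        induction hs using Finset.Nonempty.cons_induction with
        | singleton a => intro h; exact ⟨a, by simp, by simpa using h⟩
        | cons a s ha hs ih2 =>
          intro h
          obtain ⟨x, hx, hxs⟩ := ih2 fun x hx => h x (by simp [hx])
          have haa := h a (by simp)
          rcases p.weaklyConnected a x haa (h x (by simp [hx])) with hax | hxa
          · refine ⟨a, by simp, fun y hy => ?_⟩
            rcases Finset.mem_cons.1 hy with rfl | hy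
            · exact haa
            · exact p.trans _ _ _ hax (hxs y hy)
          · refine ⟨x, by simp [hx], fun y hy => ?_⟩
            rcases Finset.mem_cons.1 hy with rfl | hy
            · exact hxa
            · exact hxs y hy
      obtain ⟨x, hx, hxs⟩ := key _ hne (by simp)
      exact ⟨x, (memX x).2 ⟨by simpa using hx, fun y hy => hxs y (by simpa using hy)⟩⟩
    let p' : OPP n :=
      { rel := fun x y => x ∉ X ∧ y ∉ X ∧ p.rel x y
        trans := fun x y z h h' => ⟨h.1, h'.2.1, p.trans _ _ _ h.2.2 h'.2.2⟩
        weaklyRefl := fun x y h => ⟨⟨h.1, h.1, (p.weaklyRefl _ _ h.2.2).1⟩,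
          ⟨h.2.1, h.2.1, (p.weaklyRefl _ _ h.2.2).2⟩⟩
        weaklyConnected := fun x y hx hy =>
          (p.weaklyConnected x y hx.2.2 hy.2.2).imp (fun h => ⟨hx.1, hy.1, h⟩)
            (fun h => ⟨hy.1, hx.1, h⟩) }
    have hlt : (Finset.univ.filter fun x => p'.rel x x).card < k := by
      rw [← hk]
      apply Finset.card_lt_card
      obtain ⟨x, hx⟩ := hX
      refine (Finset.ssubset_iff_of_subset ?_).2 ⟨x, ?_, ?_⟩
      · intro y hy
        simp only [Finset.mem_filter, Finset.mem_univ, true_and] at hy ⊢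
        exact hy.2.2
      · simpa using ((memX x).1 hx).1
      · intro hy
        simp only [Finset.mem_filter, Finset.mem_univ, true_and] at hy
        exact hy.1 hx
    obtain ⟨t, ht⟩ := ih _ hlt p' (by congr)
    have hrel : ∀ x y, partsRel t.parts x y ↔ x ∉ X ∧ y ∉ X ∧ p.rel x y := by
      intro x y
      exact iff_of_eq (congrFun (congrFun (congrArg OPP.rel ht) x) y)
    refine ⟨⟨X :: t.parts, ?_, ?_⟩, ?_⟩
    · intro Y hY
      rcases List.mem_cons.1 hY with rfl | hY
      · exact hX
      · exact t.nonempty Y hY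
    · refine List.pairwise_cons.2 ⟨fun Y hY => ?_, t.disjoint⟩
      rw [Finset.disjoint_left]
      intro x hx hxY
      exact ((hrel x x).1 (partsRel_self.2 ⟨Y, hY, hxY⟩)).1 hx
    · ext x y
      change partsRel (X :: t.parts) x y ↔ p.rel x y
      rw [partsRel_cons, ← partsRel_self, hrel, hrel]
      constructor
      · rintro (⟨hx, hy | hy⟩ | h)
        · exact ((memX x).1 hx).2 y ((memX y).1 hy).1
        · exact ((memX x).1 hx).2 y hy.2.2
        · exact h.2.2
      · intro h
        have hr := p.weaklyRefl _ _ h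
        by_cases hx : x ∈ X
        · left
          refine ⟨hx, ?_⟩
          by_cases hy : y ∈ X
          · exact Or.inl hy
          · exact Or.inr ⟨hy, hy, hr.2⟩
        · refine Or.inr ⟨hx, fun hy => hx ?_, h⟩
          exact (memX x).2 ⟨hr.1, fun w hw => p.trans _ _ _ h (((memX y).1 hy).2 w hw)⟩
  · refine ⟨⟨[], by simp, by simp⟩, ?_⟩
    ext x y
    constructor
    · intro h; exact (partsRel_nil _ _ h).elim
    · intro h
      exact (hne ⟨x, by simpa using (p.weaklyRefl _ _ h).1⟩).elim

/-- The bijection between tuples and relations. -/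
noncomputable def OPPTuple.equivOPP (n : ℕ) : OPPTuple n ≃ OPP n :=
  Equiv.ofBijective OPPTuple.toOPP
    ⟨fun s t h => OPPTuple.ext (parts_eq_of_partsRel s.nonempty t.nonempty s.disjoint t.disjoint
        fun x y => iff_of_eq (congrFun (congrFun (congrArg OPP.rel h) x) y)),
      OPP.exists_tuple⟩

/-- The move of `z` in `(X₁, …, X_k)` when `z` lies in some part: if `X₁ = {z}`, discard `X₁`;
if `X_j = {z}` with `j ≥ 2`, merge it into `X_{j-1}`; if `z ∈ X_j ≠ {z}`, replace `X_j` by the two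
consecutive parts `X_j \ {z}`, `{z}`. -/
def movePresent {n : ℕ} (z : Fin n) : List (Finset (Fin n)) → List (Finset (Fin n))
  | [] => []
  | [X] =>
    if X = {z} then []
    else if z ∈ X then [X.erase z, {z}]
    else [X]
  | X :: Y :: L =>
    if X = {z} then Y :: L
    else if z ∈ X then X.erase z :: {z} :: Y :: L
    else if Y = {z} then insert z X :: L
    else X :: movePresent z (Y :: L)

/-- The action of `f_z` on tuples: if `z` lies in no part, `{z}` becomes the new first part. -/
def flipParts {n : ℕ} (z : Fin n) (L : List (Finset (Fin n))) : List (Finset (Fin n)) :=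
  if ∃ X ∈ L, z ∈ X then movePresent z L else {z} :: L

theorem movePresent_valid {n : ℕ} (z : Fin n) (L : List (Finset (Fin n)))
    (hne : ∀ X ∈ L, X.Nonempty) (hd : L.Pairwise Disjoint) :
    (∀ X ∈ movePresent z L, X.Nonempty) ∧ (movePresent z L).Pairwise Disjoint ∧
      ∀ Y ∈ movePresent z L, ∀ x ∈ Y, x = z ∨ ∃ X ∈ L, x ∈ X := by
  have er : ∀ X : Finset (Fin n), z ∈ X → X ≠ {z} → (X.erase z).Nonempty := by
    intro X hz hX
    rw [Finset.nonempty_iff_ne_empty, Ne, Finset.erase_eq_empty_iff]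
    rintro (rfl | h)
    · simp at hz
    · exact hX h
  induction L with
  | nil => simp [movePresent]
  | cons X M ih =>
    rw [List.pairwise_cons] at hd
    have hneM : ∀ Y ∈ M, Y.Nonempty := fun Y hY => hne Y (by simp [hY])
    have hXne := hne X (by simp)
    specialize ih hneM hd.2
    rcases M with _ | ⟨Y, L⟩
    · rw [movePresent]
      split_ifs with h1 h2
      · simp
      · refine ⟨?_, ?_, ?_⟩
        · simp [er X h2 h1]
        · simp
        · simp only [List.mem_cons, List.not_mem_nil, or_false]
          rintro W (rfl | rfl) x hx
          · exact Or.inr ⟨X, rfl, Finset.mem_of_mem_erase hx⟩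
          · exact Or.inl (by simpa using hx)
      · refine ⟨by simpa using hXne, by simp, ?_⟩
        intro W hW x hx
        exact Or.inr ⟨W, hW, hx⟩
    · rw [movePresent]
      split_ifs with h1 h2 h3
      · refine ⟨hneM, hd.2, fun W hW x hx => Or.inr ⟨W, by simp [List.mem_cons.1 hW], hx⟩⟩
      · refine ⟨?_, ?_, ?_⟩
        · intro W hW
          rcases List.mem_cons.1 hW with rfl | hW
          · exact er X h2 h1
          rcases List.mem_cons.1 hW with rfl | hW
          · simp
          · exact hneM W hW
        · refine List.pairwise_cons.2 ⟨?_, List.pairwise_cons.2 ⟨?_, hd.2⟩⟩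
          · intro W hW
            rcases List.mem_cons.1 hW with rfl | hW
            · simp
            · exact (hd.1 W hW).mono_left (Finset.erase_subset _ _)
          · intro W hW
            exact (hd.1 W hW).mono_left (by simpa using h2)
        · intro W hW x hx
          rcases List.mem_cons.1 hW with rfl | hW
          · exact Or.inr ⟨X, by simp, Finset.mem_of_mem_erase hx⟩
          rcases List.mem_cons.1 hW with rfl | hW
          · exact Or.inl (by simpa using hx)
          · exact Or.inr ⟨W, List.mem_cons_of_mem _ hW, hx⟩
      · have hd2 := List.pairwise_cons.1 hd.2
        refine ⟨?_, ?_, ?_⟩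
        · intro W hW
          rcases List.mem_cons.1 hW with rfl | hW
          · simp
          · exact hneM W (by simp [hW])
        · refine List.pairwise_cons.2 ⟨?_, hd2.2⟩
          intro W hW
          rw [Finset.insert_eq, Finset.disjoint_union_left]
          exact ⟨h3 ▸ hd2.1 W hW, hd.1 W (by simp [hW])⟩
        · intro W hW x hx
          rcases List.mem_cons.1 hW with rfl | hW
          · rcases Finset.mem_insert.1 hx with rfl | hx
            · exact Or.inl rfl
            · exact Or.inr ⟨X, by simp, hx⟩
          · exact Or.inr ⟨W, by simp [hW], hx⟩
      · refine ⟨?_, ?_, ?_⟩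
        · intro W hW
          rcases List.mem_cons.1 hW with rfl | hW
          · exact hXne
          · exact ih.1 W hW
        · refine List.pairwise_cons.2 ⟨?_, ih.2.1⟩
          intro W hW
          rw [Finset.disjoint_left]
          intro x hxX hxW
          rcases ih.2.2 W hW x hxW with rfl | ⟨V, hV, hxV⟩
          · exact h2 hxX
          · exact Finset.disjoint_left.1 (hd.1 V hV) hxX hxV
        · intro W hW x hx
          rcases List.mem_cons.1 hW with rfl | hW
          · exact Or.inr ⟨W, by simp, hx⟩
          · rcases ih.2.2 W hW x hx with h | ⟨V, hV, hxV⟩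
            · exact Or.inl h
            · exact Or.inr ⟨V, List.mem_cons_of_mem _ hV, hxV⟩

/-- `f_z` on tuples. -/
def OPPTuple.flip {n : ℕ} (z : Fin n) (t : OPPTuple n) : OPPTuple n where
  parts := flipParts z t.parts
  nonempty := by
    rw [flipParts]
    split_ifs with h
    · exact (movePresent_valid z t.parts t.nonempty t.disjoint).1
    · simpa using t.nonempty
  disjoint := by
    rw [flipParts]
    split_ifs with h
    · exact (movePresent_valid z t.parts t.nonempty t.disjoint).2.1
    · refine List.pairwise_cons.2 ⟨fun Y hY => ?_, t.disjoint⟩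
      rw [Finset.disjoint_singleton_left]
      exact fun hz => h ⟨Y, hY, hz⟩

/-- The map `f_z : OPP(n) → OPP(n)`. -/
noncomputable def OPP.flip {n : ℕ} (z : Fin n) (p : OPP n) : OPP n :=
  OPPTuple.equivOPP n (OPPTuple.flip z ((OPPTuple.equivOPP n).symm p))

/-- `f_z` exchanges `p` and `q`. -/
def OPP.Swapped {n : ℕ} (z : Fin n) (p q : OPP n) : Prop :=
  OPP.flip z p = q ∧ OPP.flip z q = p

/-- The flip graph of `OPP(n)`. -/
def flipGraph (n : ℕ) : SimpleGraph (OPP n) where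
  Adj p q := p ≠ q ∧ ∃ z, OPP.Swapped z p q
  symm := ⟨fun _ _ h => ⟨h.1.symm, h.2.imp fun _ hz => ⟨hz.2, hz.1⟩⟩⟩
  loopless := ⟨fun _ h => h.1 rfl⟩

/-- The cuboid `C_A = ∏ᵢ [0, a_{i,i}]`. -/
def cuboid {n : ℕ} (A : Matrix (Fin n) (Fin n) ℝ) : Set (Fin n → ℝ) :=
  Set.univ.pi fun i => Set.Icc 0 (A i i)

/-- The polytope `F_A`: the closure of `C_A` minus its translates by sums of nonempty sets of
columns of `A`. -/
def polytopeF {n : ℕ} (A : Matrix (Fin n) (Fin n) ℝ) : Set (Fin n → ℝ) :=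
  closure (cuboid A \ ⋃ (S : Finset (Fin n)) (_ : S.Nonempty),
    {y | ∃ x ∈ cuboid A, y = x + ∑ i ∈ S, A *ᵥ Pi.single i 1})

section Faces

variable {E : Type*} [AddCommGroup E] [Module ℝ E]

/-- The cone of directions along which a short segment starting at `x` stays in `P`. For a finite
union of convex polytopes it determines `P` near `x`. -/
def localCone (P : Set E) (x : E) : Set E :=
  {d | ∀ᶠ t : ℝ in 𝓝[>] 0, x + t • d ∈ P}

/-- The directions along which the local cone of `P` at `x` is translation invariant. For a
(not necessarily convex) polytope `P` and `x ∈ P` this is the direction space of the face of `P`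
whose relative interior contains `x`. -/
def faceDirection (P : Set E) (x : E) : Submodule ℝ E where
  carrier := {u | ∀ d ∈ localCone P x, ∀ c : ℝ, d + c • u ∈ localCone P x}
  add_mem' := by
    intro u v hu hv d hd c
    rw [smul_add, ← add_assoc]
    exact hv _ (hu d hd c) c
  zero_mem' := by
    intro d hd c
    simpa using hd
  smul_mem' := by
    intro a u hu d hd c
    rw [smul_smul]
    exact hu d hd (c * a)

/-- The vertices (`0`-dimensional faces) of a not necessarily convex polytope `P`. -/
def vertexSet (P : Set E) : Set E :=
  {x | x ∈ P ∧ faceDirection P x = ⊥}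

/-- `v` and `w` are connected by an edge (a `1`-dimensional face) of `P`: they are distinct
vertices, and the open segment between them lies in the relative interior of a `1`-dimensional
face. -/
def IsEdge (P : Set E) (v w : E) : Prop :=
  v ≠ w ∧ v ∈ vertexSet P ∧ w ∈ vertexSet P ∧
    ∀ x ∈ openSegment ℝ v w, x ∈ P ∧ faceDirection P x = Submodule.span ℝ {w - v}

theorem IsEdge.symm {P : Set E} {v w : E} (h : IsEdge P v w) : IsEdge P w v := by
  refine ⟨h.1.symm, h.2.2.1, h.2.1, fun x hx => ?_⟩
  have hx' := h.2.2.2 x (by rwa [openSegment_symm])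
  refine ⟨hx'.1, hx'.2.trans ?_⟩
  rw [← neg_sub v w, ← Set.neg_singleton, Submodule.span_neg]

/-- The 1-skeleton of `P`: the graph of its vertices and edges. -/
def oneSkeleton (P : Set E) : SimpleGraph (vertexSet P) where
  Adj v w := IsEdge P v w
  symm := ⟨fun _ _ h => h.symm⟩
  loopless := ⟨fun _ h => h.1 rfl⟩

end Faces

open Classical in
/-- The point with coordinates `v_i = ∑_{j : i ≼ j} a_{i,j}`. -/
noncomputable def OPP.point {n : ℕ} (A : Matrix (Fin n) (Fin n) ℝ) (p : OPP n) : Fin n → ℝ :=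
  fun i => ∑ j with p.rel i j, A i j

/-!
Write `s_i(S) = ∑ j ∈ S, a_{i,j}`. For `i ∈ S` this number is positive, and it decreases strictly
when `S` grows. By a maximality argument this monotonicity makes the upper bounds of the translated
cuboids irrelevant, so the polytope is the set of `x ≥ 0` such that every nonempty `S` contains an
`i` with `x_i ≤ s_i(S)` (`IsFlipMatrix.mem_polytopeF_iff`), a continuous analogue of the set of
parking functions.

Call `S` tight at `x` if `s_i(S) ≤ x_i` for all `i ∈ S`. The tight sets at a point of the polytope
form a chain (`IsTight.subset_or_subset`), and a coordinate satisfies `x_i = s_i(S)` for at most one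
tight `S` containing `i`. Hence the local cone is a product over the disjoint sets of such active
coordinates, and the direction space of the face through `x` is spanned by the `e_i` for which `i`
is neither zero nor active (`IsFlipMatrix.mem_faceDirection_iff`).

A vertex is therefore a point all of whose coordinates are zero or active. Letting `{j | i ≼ j}` be
the tight set in which `i` is active, and empty if `x_i = 0`, turns the chain of tight sets into an
ordered partial partition (`IsFlipMatrix.exists_point_eq`); conversely the point of an ordered
partial partition has exactly its upper sets as tight sets with an active coordinate
(`OPP.isActive_upperSet`, `OPP.upperSet_eq_of_isActive`).

Along an edge parallel to `e_i` all coordinates other than `i` stay zero or active in the same tight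
set, so the two ends have the same upper sets except for the one of `i`
(`IsFlipMatrix.upperSet_eq_of_isEdge`), and the converse holds as well
(`IsFlipMatrix.isEdge_of_upperSet_eq`). The flip of `i` has the same description: it changes the
row of `i` of the relation and nothing else, and the other rows leave only two possibilities for
this row, according to whether `{i}` is a part (`OPP.eq_of_agree`, `OPP.swapped_iff`).
-/

/-! ### Partial row sums -/

/-- The hypotheses on the matrix: positive diagonal, negative off-diagonal entries and positive
row sums. -/
structure IsFlipMatrix {n : ℕ} (A : Matrix (Fin n) (Fin n) ℝ) : Prop where
  diag_pos : ∀ i, 0 < A i i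
  offDiag_neg : ∀ i j, i ≠ j → A i j < 0
  rowSum_pos : ∀ i, 0 < ∑ j, A i j

/-- The sum of the entries of row `i` over the columns in `S`; it is the `i`-th coordinate of the
translation vector `∑ j ∈ S, A e_j`. -/
def partialRowSum {n : ℕ} (A : Matrix (Fin n) (Fin n) ℝ) (S : Finset (Fin n)) (i : Fin n) : ℝ :=
  ∑ j ∈ S, A i j

section RowSums

variable {n : ℕ} {A : Matrix (Fin n) (Fin n) ℝ} {S T : Finset (Fin n)} {i : Fin n}

theorem partialRowSum_empty : partialRowSum A ∅ i = 0 := Finset.sum_empty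

theorem partialRowSum_singleton : partialRowSum A {i} i = A i i := Finset.sum_singleton _ _

theorem partialRowSum_insert (hi : i ∉ S) :
    partialRowSum A (insert i S) i = A i i + partialRowSum A S i :=
  Finset.sum_insert hi

theorem IsFlipMatrix.partialRowSum_lt (hA : IsFlipMatrix A) (hi : i ∈ S) (h : S ⊂ T) :
    partialRowSum A T i < partialRowSum A S i := by
  obtain ⟨k, hkT, hkS⟩ := Finset.exists_of_ssubset h
  have hneg : ∑ j ∈ T \ S, A i j < 0 := by
    refine Finset.sum_neg (fun j hj => hA.offDiag_neg i j ?_)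
      ⟨k, Finset.mem_sdiff.2 ⟨hkT, hkS⟩⟩
    rintro rfl
    exact (Finset.mem_sdiff.1 hj).2 hi
  have := Finset.sum_sdiff (f := fun j => A i j) h.1
  unfold partialRowSum
  linarith

theorem IsFlipMatrix.partialRowSum_le (hA : IsFlipMatrix A) (hi : i ∈ S) (h : S ⊆ T) :
    partialRowSum A T i ≤ partialRowSum A S i := by
  rcases h.eq_or_ssubset with rfl | h
  · exact le_rfl
  · exact (hA.partialRowSum_lt hi h).le

theorem IsFlipMatrix.eq_of_partialRowSum_le (hA : IsFlipMatrix A) (hi : i ∈ S) (h : S ⊆ T)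
    (hle : partialRowSum A S i ≤ partialRowSum A T i) : S = T := by
  by_contra hne
  exact absurd (hA.partialRowSum_lt hi (h.ssubset_of_ne hne)) (not_lt.2 hle)

theorem IsFlipMatrix.partialRowSum_pos (hA : IsFlipMatrix A) (hi : i ∈ S) :
    0 < partialRowSum A S i :=
  (hA.rowSum_pos i).trans_le (hA.partialRowSum_le hi (Finset.subset_univ S))

theorem IsFlipMatrix.partialRowSum_nonpos (hA : IsFlipMatrix A) (hi : i ∉ S) :
    partialRowSum A S i ≤ 0 :=
  Finset.sum_nonpos fun j hj => (hA.offDiag_neg i j fun h => hi (h ▸ hj)).le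

theorem sum_mulVec_single_apply (S : Finset (Fin n)) (i : Fin n) :
    (∑ j ∈ S, A *ᵥ Pi.single j 1) i = partialRowSum A S i := by
  simp [partialRowSum, Finset.sum_apply]

end RowSums

/-! ### The polytope as a set of inequalities -/

section Inequalities

variable {n : ℕ} {A : Matrix (Fin n) (Fin n) ℝ}

theorem mem_translate_cuboid_iff (S : Finset (Fin n)) (x : Fin n → ℝ) :
    (∃ y ∈ cuboid A, x = y + ∑ j ∈ S, A *ᵥ Pi.single j 1) ↔
      ∀ i, partialRowSum A S i ≤ x i ∧ x i ≤ A i i + partialRowSum A S i := by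
  constructor
  · rintro ⟨y, hy, rfl⟩ i
    have := hy i trivial
    rw [Pi.add_apply, sum_mulVec_single_apply]
    exact ⟨by linarith [this.1], by linarith [this.2]⟩
  · intro h
    refine ⟨x - ∑ j ∈ S, A *ᵥ Pi.single j 1, fun i _ => ?_, by simp⟩
    rw [Pi.sub_apply, sum_mulVec_single_apply]
    exact ⟨by linarith [(h i).1], by linarith [(h i).2]⟩

/-- A point of the cuboid that avoids every translate satisfies the strict parking inequalities.
The upper constraints of the translates can be ignored: a largest nonempty `S` with
`partialRowSum A S i ≤ x i` on `S` satisfies them, since otherwise it could be enlarged. -/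
theorem IsFlipMatrix.mem_cuboid_diff_iff (hA : IsFlipMatrix A) (x : Fin n → ℝ) :
    x ∈ cuboid A \ ⋃ (S : Finset (Fin n)) (_ : S.Nonempty),
        {y | ∃ x ∈ cuboid A, y = x + ∑ i ∈ S, A *ᵥ Pi.single i 1} ↔
      (∀ i, 0 ≤ x i) ∧ ∀ S : Finset (Fin n), S.Nonempty → ∃ i ∈ S, x i < partialRowSum A S i := by
  simp only [Set.mem_sdiff, Set.mem_iUnion, Set.mem_ofPred_eq, mem_translate_cuboid_iff,
    exists_prop, not_exists, not_and]
  constructor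
  · rintro ⟨hx, h⟩
    refine ⟨fun i => (hx i trivial).1, fun S hS => ?_⟩
    by_contra! hcon
    obtain ⟨M, hSM, hM⟩ := (Set.toFinite
      {T : Finset (Fin n) | T.Nonempty ∧ ∀ i ∈ T, partialRowSum A T i ≤ x i}).exists_le_maximal
      (a := S) ⟨hS, hcon⟩
    refine h M hM.prop.1 fun i => ?_
    by_cases hi : i ∈ M
    · refine ⟨hM.prop.2 i hi, (hx i trivial).2.trans ?_⟩
      linarith [hA.partialRowSum_pos hi]
    · refine ⟨(hA.partialRowSum_nonpos hi).trans (hx i trivial).1, ?_⟩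
      by_contra! hlt
      rw [← partialRowSum_insert hi] at hlt
      refine hi (hM.le_of_ge (y := insert i M) ⟨Finset.insert_nonempty _ _, fun j hj => ?_⟩
        (Finset.subset_insert _ _) (Finset.mem_insert_self _ _))
      rcases Finset.mem_insert.1 hj with rfl | hj
      · exact hlt.le
      · exact (hA.partialRowSum_le hj (Finset.subset_insert _ _)).trans (hM.prop.2 j hj)
  · rintro ⟨h0, h⟩
    refine ⟨fun i _ => ⟨h0 i, ?_⟩, fun S hS hcon => ?_⟩
    · obtain ⟨j, hj, hlt⟩ := h {i} (Finset.singleton_nonempty i)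
      rw [Finset.mem_singleton] at hj
      subst hj
      rw [partialRowSum_singleton] at hlt
      exact hlt.le
    · obtain ⟨i, -, hlt⟩ := h S hS
      exact absurd (hcon i).1 (not_le.2 hlt)

/-- The polytope is the set of real parking functions of `A`. Passing to the closure makes the
inequalities weak because shrinking a point towards the origin makes them strict again. -/
theorem IsFlipMatrix.mem_polytopeF_iff (hA : IsFlipMatrix A) (x : Fin n → ℝ) :
    x ∈ polytopeF A ↔
      (∀ i, 0 ≤ x i) ∧
        ∀ S : Finset (Fin n), S.Nonempty → ∃ i ∈ S, x i ≤ partialRowSum A S i := by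
  constructor
  · intro hx
    have hcl : IsClosed {x : Fin n → ℝ | (∀ i, 0 ≤ x i) ∧
        ∀ S : Finset (Fin n), S.Nonempty → ∃ i ∈ S, x i ≤ partialRowSum A S i} := by
      have : {x : Fin n → ℝ | (∀ i, 0 ≤ x i) ∧
          ∀ S : Finset (Fin n), S.Nonempty → ∃ i ∈ S, x i ≤ partialRowSum A S i} =
          (⋂ i, {x | 0 ≤ x i}) ∩ ⋂ (S : Finset (Fin n)) (_ : S.Nonempty),
            ⋃ i ∈ S, {x | x i ≤ partialRowSum A S i} := by
        ext x
        simp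
      rw [this]
      refine (isClosed_iInter fun i => isClosed_le continuous_const (continuous_apply i)).inter
        (isClosed_iInter fun S => isClosed_iInter fun _ => ?_)
      exact S.finite_toSet.isClosed_biUnion fun i _ =>
        isClosed_le (continuous_apply i) continuous_const
    refine closure_minimal (fun y hy => ?_) hcl hx
    obtain ⟨h0, h⟩ := (hA.mem_cuboid_diff_iff y).1 hy
    exact ⟨h0, fun S hS => (h S hS).imp fun i hi => ⟨hi.1, hi.2.le⟩⟩
  · rintro ⟨h0, h⟩
    have hlim : Filter.Tendsto (fun t : ℝ => (1 - t) • x) (𝓝[>] 0) (𝓝 x) := by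
      have : Continuous fun t : ℝ => (1 - t) • x := by fun_prop
      simpa using (this.tendsto 0).mono_left nhdsWithin_le_nhds
    refine mem_closure_of_tendsto hlim ?_
    filter_upwards [Ioo_mem_nhdsGT (zero_lt_one' ℝ)] with t ht
    rw [hA.mem_cuboid_diff_iff]
    refine ⟨fun i => mul_nonneg (by linarith [ht.2]) (h0 i), fun S hS => ?_⟩
    obtain ⟨i, hi, hle⟩ := h S hS
    refine ⟨i, hi, ?_⟩
    have hpos := hA.partialRowSum_pos hi
    have h1 : (1 - t) * x i ≤ (1 - t) * partialRowSum A S i :=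
      mul_le_mul_of_nonneg_left hle (by linarith [ht.2])
    have h2 : 0 < t * partialRowSum A S i := mul_pos ht.1 hpos
    simp only [Pi.smul_apply, smul_eq_mul]
    linarith

end Inequalities

/-! ### Tight sets and the direction space of a face -/

section Faces

variable {n : ℕ} {A : Matrix (Fin n) (Fin n) ℝ} {x : Fin n → ℝ} {S T : Finset (Fin n)} {i : Fin n}

/-- A nonempty `S` is tight at `x` if no inequality `x i ≤ partialRowSum A S i` with `i ∈ S` holds
strictly. -/
def IsTight (A : Matrix (Fin n) (Fin n) ℝ) (x : Fin n → ℝ) (S : Finset (Fin n)) : Prop :=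
  S.Nonempty ∧ ∀ i ∈ S, partialRowSum A S i ≤ x i

/-- `S` is a tight set in whose inequality the coordinate `i` is active. -/
def IsActive (A : Matrix (Fin n) (Fin n) ℝ) (x : Fin n → ℝ) (S : Finset (Fin n)) (i : Fin n) :
    Prop :=
  IsTight A x S ∧ i ∈ S ∧ x i = partialRowSum A S i

/-- The coordinate `i` is blocked at `x` if it lies on the boundary of the orthant or is active in
a tight set. The other coordinates can be moved freely near `x`. -/
def IsBlocked (A : Matrix (Fin n) (Fin n) ℝ) (x : Fin n → ℝ) (i : Fin n) : Prop :=
  x i = 0 ∨ ∃ S, IsActive A x S i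

/-- The tight sets at a point of the polytope form a chain: an index at which the inequality of
`S ∪ T` holds lies in one of them, which then has to be all of `S ∪ T`. -/
theorem IsTight.subset_or_subset (hA : IsFlipMatrix A) (hx : x ∈ polytopeF A)
    (hS : IsTight A x S) (hT : IsTight A x T) : S ⊆ T ∨ T ⊆ S := by
  obtain ⟨i, hi, hle⟩ := ((hA.mem_polytopeF_iff x).1 hx).2 (S ∪ T)
    (hS.1.mono Finset.subset_union_left)
  rcases Finset.mem_union.1 hi with hi | hi
  · right
    have := hA.eq_of_partialRowSum_le hi (Finset.subset_union_left (s₂ := T))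
      ((hS.2 i hi).trans hle)
    exact this ▸ Finset.subset_union_right
  · left
    have := hA.eq_of_partialRowSum_le hi (Finset.subset_union_right (s₁ := S))
      ((hT.2 i hi).trans hle)
    exact this ▸ Finset.subset_union_left

theorem IsActive.subset_of_mem (hA : IsFlipMatrix A) (hx : x ∈ polytopeF A)
    (hS : IsActive A x S i) (hT : IsTight A x T) (hi : i ∈ T) : S ⊆ T := by
  rcases hS.1.subset_or_subset hA hx hT with h | h
  · exact h
  · exact (hA.eq_of_partialRowSum_le hi h ((hT.2 i hi).trans hS.2.2.le)).ge

theorem IsActive.unique (hA : IsFlipMatrix A) (hx : x ∈ polytopeF A)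
    (hS : IsActive A x S i) (hT : IsActive A x T i) : S = T :=
  (hS.subset_of_mem hA hx hT.1 hT.2.1).antisymm (hT.subset_of_mem hA hx hS.1 hS.2.1)

theorem IsTight.exists_isActive (hA : IsFlipMatrix A) (hx : x ∈ polytopeF A)
    (hS : IsTight A x S) : ∃ i, IsActive A x S i := by
  obtain ⟨i, hi, hle⟩ := ((hA.mem_polytopeF_iff x).1 hx).2 S hS.1
  exact ⟨i, hS, hi, hle.antisymm (hS.2 i hi)⟩

theorem IsTight.pos_of_mem (hA : IsFlipMatrix A) (hS : IsTight A x S) (hi : i ∈ S) : 0 < x i :=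
  (hA.partialRowSum_pos hi).trans_le (hS.2 i hi)

theorem eventually_add_mul_lt {a b c : ℝ} (h : a < c) : ∀ᶠ t : ℝ in 𝓝[>] 0, a + t * b < c := by
  have hc : Continuous fun t : ℝ => a + t * b := by fun_prop
  have : Filter.Tendsto (fun t : ℝ => a + t * b) (𝓝[>] 0) (𝓝 a) := by
    simpa using (hc.tendsto 0).mono_left nhdsWithin_le_nhds
  exact this.eventually_lt_const h

theorem eventually_add_mul_le_iff {a b c : ℝ} :
    (∀ᶠ t : ℝ in 𝓝[>] 0, a + t * b ≤ c) ↔ a < c ∨ a = c ∧ b ≤ 0 := by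
  constructor
  · intro h
    have hc : Continuous fun t : ℝ => a + t * b := by fun_prop
    have hlim : Filter.Tendsto (fun t : ℝ => a + t * b) (𝓝[>] 0) (𝓝 a) := by
      simpa using (hc.tendsto 0).mono_left nhdsWithin_le_nhds
    rcases (le_of_tendsto hlim h).lt_or_eq with hlt | rfl
    · exact Or.inl hlt
    · obtain ⟨t, ht, ht0⟩ := (h.and self_mem_nhdsWithin).exists
      have ht0 : 0 < t := ht0
      exact Or.inr ⟨rfl, by by_contra! hb; linarith [mul_pos ht0 hb]⟩
  · rintro (h | ⟨rfl, hb⟩)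
    · exact (eventually_add_mul_lt h).mono fun t ht => ht.le
    · filter_upwards [self_mem_nhdsWithin] with t ht
      have ht : 0 < t := ht
      linarith [mul_nonpos_of_nonneg_of_nonpos ht.le hb]

theorem eventually_not_add_mul_le {a b c : ℝ} (h : ¬ (a < c ∨ a = c ∧ b ≤ 0)) :
    ∀ᶠ t : ℝ in 𝓝[>] 0, c < a + t * b := by
  push Not at h
  rcases h.1.lt_or_eq with hlt | rfl
  · filter_upwards [eventually_add_mul_lt (b := -b) (neg_lt_neg hlt)] with t ht
    linarith
  · filter_upwards [self_mem_nhdsWithin] with t ht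
    have ht : 0 < t := ht
    linarith [mul_pos ht (h.2 rfl)]

/-- The local cone is cut out by the active inequalities. -/
theorem IsFlipMatrix.mem_localCone_iff (hA : IsFlipMatrix A) (hx : x ∈ polytopeF A)
    (d : Fin n → ℝ) :
    d ∈ localCone (polytopeF A) x ↔
      (∀ i, x i = 0 → 0 ≤ d i) ∧ ∀ S, IsTight A x S → ∃ i, IsActive A x S i ∧ d i ≤ 0 := by
  have hF := (hA.mem_polytopeF_iff x).1 hx
  have hcone : d ∈ localCone (polytopeF A) x ↔ ∀ᶠ t : ℝ in 𝓝[>] 0,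
      (∀ i, -x i + t * -d i ≤ 0) ∧ ∀ S : Finset (Fin n), S.Nonempty →
        ∃ i ∈ S, x i + t * d i ≤ partialRowSum A S i := by
    change (∀ᶠ t : ℝ in 𝓝[>] 0, x + t • d ∈ polytopeF A) ↔ _
    refine Filter.eventually_congr (Filter.Eventually.of_forall fun t => ?_)
    rw [hA.mem_polytopeF_iff]
    refine and_congr (forall_congr' fun i => ?_) Iff.rfl
    simp only [Pi.add_apply, Pi.smul_apply, smul_eq_mul]
    constructor <;> intro h <;> linarith
  rw [hcone, Filter.eventually_and, Filter.eventually_all, Filter.eventually_all]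
  refine and_congr (forall_congr' fun i => ?_) (forall_congr' fun S => ?_)
  · rw [eventually_add_mul_le_iff]
    constructor
    · rintro (h | h) h0
      · linarith
      · linarith [h.2]
    · intro h
      rcases (hF.1 i).lt_or_eq with h0 | h0
      · exact Or.inl (by linarith)
      · exact Or.inr ⟨by linarith, by linarith [h h0.symm]⟩
  · constructor
    · intro h hS
      by_contra! hcon
      have hall : ∀ᶠ t : ℝ in 𝓝[>] 0, ∀ i ∈ S, partialRowSum A S i < x i + t * d i := by
        refine (Filter.eventually_all_finset S).2 fun i hi => eventually_not_add_mul_le ?_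
        rintro (hlt | ⟨heq, hd⟩)
        · exact absurd (hS.2 i hi) (not_le.2 hlt)
        · exact absurd hd (not_le.2 (hcon i ⟨hS, hi, heq⟩))
      obtain ⟨t, ht, ht'⟩ := (h.and hall).exists
      obtain ⟨i, hi, hle⟩ := ht hS.1
      exact absurd hle (not_le.2 (ht' i hi))
    · intro h
      by_cases hS : IsTight A x S
      · obtain ⟨i, hi, hd⟩ := h hS
        filter_upwards [eventually_add_mul_le_iff.2 (Or.inr ⟨hi.2.2, hd⟩)] with t ht _
        exact ⟨i, hi.2.1, ht⟩
      · by_cases hne : S.Nonempty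
        · have : ∃ i ∈ S, x i < partialRowSum A S i := by
            by_contra! hcon
            exact hS ⟨hne, hcon⟩
          obtain ⟨i, hi, hlt⟩ := this
          filter_upwards [eventually_add_mul_lt (b := d i) hlt] with t ht _
          exact ⟨i, hi, ht.le⟩
        · exact Filter.Eventually.of_forall fun t h => absurd h hne

/-- The direction space of the face through `x` is the coordinate subspace of the free
coordinates. Since the sets of active coordinates are disjoint for distinct tight sets, the local
cone is a product of half-lines, lines, and complements of open positive orthants; only the lines
contribute. -/
theorem IsFlipMatrix.mem_faceDirection_iff (hA : IsFlipMatrix A) (hx : x ∈ polytopeF A)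
    (u : Fin n → ℝ) :
    u ∈ faceDirection (polytopeF A) x ↔ ∀ i, IsBlocked A x i → u i = 0 := by
  classical
  change (∀ d ∈ localCone (polytopeF A) x, ∀ c : ℝ, d + c • u ∈ localCone (polytopeF A) x) ↔ _
  simp only [hA.mem_localCone_iff hx]
  constructor
  · rintro h i (h0 | ⟨S, hS⟩)
    · have h1 : ∀ c : ℝ, 0 ≤ c * u i := fun c => by
        simpa using (h 0 ⟨fun _ _ => le_rfl, fun T hT =>
          (hT.exists_isActive hA hx).imp fun _ hj => ⟨hj, le_rfl⟩⟩ c).1 i h0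
      linarith [h1 1, h1 (-1)]
    · by_contra hu
      -- At `d` the only active coordinate of `S` with `d j ≤ 0` is `i`; the multiple of `u` with
      -- `i`-th coordinate `1` makes it positive and keeps the others positive.
      let d : Fin n → ℝ := fun j =>
        if IsActive A x S j ∧ j ≠ i then 1 + |(u i)⁻¹ * u j| else 0
      have hd0 : ∀ j, 0 ≤ d j := fun j => by
        dsimp only [d]
        split_ifs <;> positivity
      have hdT : ∀ T, IsTight A x T → ∃ k, IsActive A x T k ∧ d k ≤ 0 := by
        intro T hT
        by_cases hTS : T = S
        · subst hTS
          exact ⟨i, hS, by simp [d]⟩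
        · obtain ⟨k, hk⟩ := hT.exists_isActive hA hx
          refine ⟨k, hk, ?_⟩
          dsimp only [d]
          rw [if_neg fun hk' => hTS (hk.unique hA hx hk'.1)]
      obtain ⟨j, hj, hle⟩ := (h d ⟨fun j _ => hd0 j, hdT⟩ (u i)⁻¹).2 S hS.1
      simp only [Pi.add_apply, Pi.smul_apply, smul_eq_mul, d] at hle
      by_cases hji : j = i
      · subst hji
        rw [if_neg (by simp), inv_mul_cancel₀ hu] at hle
        linarith
      · rw [if_pos ⟨hj, hji⟩] at hle
        linarith [neg_abs_le ((u i)⁻¹ * u j)]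
  · rintro h d ⟨hd0, hd⟩ c
    refine ⟨fun i hi => ?_, fun S hS => ?_⟩
    · simpa [h i (Or.inl hi)] using hd0 i hi
    · obtain ⟨i, hi, hle⟩ := hd S hS
      exact ⟨i, hi, by simpa [h i (Or.inr ⟨S, hi⟩)] using hle⟩

theorem IsFlipMatrix.mem_vertexSet_iff (hA : IsFlipMatrix A) :
    x ∈ vertexSet (polytopeF A) ↔ x ∈ polytopeF A ∧ ∀ i, IsBlocked A x i := by
  refine and_congr_right fun hx => ?_
  rw [Submodule.eq_bot_iff]
  simp only [hA.mem_faceDirection_iff hx]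
  constructor
  · intro h i
    by_contra hi
    have h1 := h (Pi.single i 1) fun j hj =>
      Pi.single_eq_of_ne (fun hji : j = i => hi (hji ▸ hj)) 1
    simpa using congrFun h1 i
  · intro h u hu
    ext i
    exact hu i (h i)

end Faces

/-! ### Vertices and ordered partial partitions -/

section Vertices

variable {n : ℕ} {A : Matrix (Fin n) (Fin n) ℝ} {x : Fin n → ℝ} {S : Finset (Fin n)} {i j : Fin n}
  {p q : OPP n}

open Classical in
/-- The set of `j` with `i ≼ j`. -/
noncomputable def OPP.upperSet (p : OPP n) (i : Fin n) : Finset (Fin n) :=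
  Finset.univ.filter fun j => p.rel i j

theorem OPP.mem_upperSet : j ∈ p.upperSet i ↔ p.rel i j := by
  simp [OPP.upperSet]

theorem OPP.point_apply (A : Matrix (Fin n) (Fin n) ℝ) (p : OPP n) (i : Fin n) :
    p.point A i = partialRowSum A (p.upperSet i) i := rfl

theorem OPP.self_mem_upperSet (h : p.rel i j) : i ∈ p.upperSet i :=
  mem_upperSet.2 (p.weaklyRefl _ _ h).1

theorem OPP.upperSet_subset (h : p.rel i j) : p.upperSet j ⊆ p.upperSet i :=
  fun _ hk => mem_upperSet.2 (p.trans _ _ _ h (mem_upperSet.1 hk))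

theorem OPP.upperSet_eq_empty (h : ¬ p.rel i i) : p.upperSet i = ∅ :=
  Finset.eq_empty_of_forall_notMem fun _ hj => h (p.weaklyRefl _ _ (mem_upperSet.1 hj)).1

theorem OPP.ext_upperSet (h : ∀ i, p.upperSet i = q.upperSet i) : p = q := by
  ext i j
  rw [← mem_upperSet, h, mem_upperSet]

/-- A nonempty set of related elements has a smallest element. -/
theorem OPP.exists_forall_rel (p : OPP n) (hS : S.Nonempty) (h : ∀ i ∈ S, p.rel i i) :
    ∃ i ∈ S, ∀ j ∈ S, p.rel i j := by
  obtain ⟨i, hi, hmax⟩ := S.exists_max_image (fun i => (p.upperSet i).card) hS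
  refine ⟨i, hi, fun j hj => ?_⟩
  rcases p.weaklyConnected i j (h i hi) (h j hj) with hij | hji
  · exact hij
  · rw [← mem_upperSet, Finset.eq_of_subset_of_card_le (upperSet_subset hji) (hmax j hj),
      mem_upperSet]
    exact h j hj

theorem OPP.point_eq_zero (h : ¬ p.rel i i) : p.point A i = 0 := by
  rw [point_apply, upperSet_eq_empty h, partialRowSum_empty]

theorem OPP.point_pos (hA : IsFlipMatrix A) (h : p.rel i i) : 0 < p.point A i :=
  hA.partialRowSum_pos (self_mem_upperSet h)

theorem OPP.point_mem_polytopeF (hA : IsFlipMatrix A) (p : OPP n) : p.point A ∈ polytopeF A := by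
  rw [hA.mem_polytopeF_iff]
  constructor
  · intro i
    by_cases h : p.rel i i
    · exact (point_pos hA h).le
    · exact (point_eq_zero h).ge
  · intro S hS
    by_cases h : ∀ i ∈ S, p.rel i i
    · obtain ⟨i, hi, hle⟩ := p.exists_forall_rel hS h
      exact ⟨i, hi, hA.partialRowSum_le hi fun j hj => mem_upperSet.2 (hle j hj)⟩
    · push Not at h
      obtain ⟨i, hi, hii⟩ := h
      exact ⟨i, hi, (point_eq_zero hii).trans_le (hA.partialRowSum_pos hi).le⟩

theorem OPP.isActive_upperSet (hA : IsFlipMatrix A) (h : p.rel i i) :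
    IsActive A (p.point A) (p.upperSet i) i := by
  refine ⟨⟨⟨i, mem_upperSet.2 h⟩, fun j hj => ?_⟩, mem_upperSet.2 h, rfl⟩
  have hj := mem_upperSet.1 hj
  exact hA.partialRowSum_le (mem_upperSet.2 (p.weaklyRefl _ _ hj).2) (upperSet_subset hj)

theorem OPP.upperSet_eq_of_isActive (hA : IsFlipMatrix A) (h : IsActive A (p.point A) S i) :
    p.upperSet i = S := by
  refine (isActive_upperSet hA ?_).unique hA (p.point_mem_polytopeF hA) h
  by_contra hi
  exact (h.1.pos_of_mem hA h.2.1).ne' (point_eq_zero hi)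

theorem OPP.isBlocked_point (hA : IsFlipMatrix A) (p : OPP n) (i : Fin n) :
    IsBlocked A (p.point A) i := by
  by_cases h : p.rel i i
  · exact Or.inr ⟨_, isActive_upperSet hA h⟩
  · exact Or.inl (point_eq_zero h)

theorem OPP.point_mem_vertexSet (hA : IsFlipMatrix A) (p : OPP n) :
    p.point A ∈ vertexSet (polytopeF A) :=
  hA.mem_vertexSet_iff.2 ⟨p.point_mem_polytopeF hA, p.isBlocked_point hA⟩

theorem OPP.upperSet_eq_of_point_eq_zero (hA : IsFlipMatrix A)
    (hi : p.point A i = 0) (hi' : q.point A i = 0) : p.upperSet i = q.upperSet i := by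
  rw [upperSet_eq_empty fun h => (point_pos hA h).ne' hi,
    upperSet_eq_empty fun h => (point_pos hA h).ne' hi']

theorem OPP.point_injective (hA : IsFlipMatrix A) :
    Function.Injective (OPP.point A : OPP n → Fin n → ℝ) := by
  intro p q h
  refine ext_upperSet fun i => ?_
  rcases q.isBlocked_point hA i with h0 | ⟨S, hS⟩
  · exact upperSet_eq_of_point_eq_zero hA ((congrFun h i).trans h0) h0
  · rw [upperSet_eq_of_isActive hA hS, upperSet_eq_of_isActive hA (h ▸ hS)]

/-- At a vertex, `i ≼ j` if `j` lies in the tight set in which `i` is active. -/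
theorem IsFlipMatrix.exists_point_eq (hA : IsFlipMatrix A) (hx : x ∈ vertexSet (polytopeF A)) :
    ∃ p : OPP n, p.point A = x := by
  obtain ⟨hxF, hb⟩ := hA.mem_vertexSet_iff.1 hx
  let p : OPP n :=
    { rel := fun i j => ∃ S, IsActive A x S i ∧ j ∈ S
      trans := by
        rintro i j k ⟨S, hS, hj⟩ ⟨T, hT, hk⟩
        exact ⟨S, hS, hT.subset_of_mem hA hxF hS.1 hj hk⟩
      weaklyRefl := by
        rintro i j ⟨S, hS, hj⟩
        refine ⟨⟨S, hS, hS.2.1⟩, ?_⟩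
        rcases hb j with h0 | ⟨T, hT⟩
        · exact absurd h0 (hS.1.pos_of_mem hA hj).ne'
        · exact ⟨T, hT, hT.2.1⟩
      weaklyConnected := by
        rintro i j ⟨S, hS, -⟩ ⟨T, hT, -⟩
        rcases hS.1.subset_or_subset hA hxF hT.1 with h | h
        · exact Or.inr ⟨T, hT, h hS.2.1⟩
        · exact Or.inl ⟨S, hS, h hT.2.1⟩ }
  refine ⟨p, funext fun i => ?_⟩
  by_cases hi : ∃ S, IsActive A x S i
  · obtain ⟨S, hS⟩ := hi
    have : p.upperSet i = S := by
      ext j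
      rw [OPP.mem_upperSet]
      constructor
      · rintro ⟨T, hT, hj⟩
        exact hS.unique hA hxF hT ▸ hj
      · exact fun hj => ⟨S, hS, hj⟩
    rw [OPP.point_apply, this, hS.2.2]
  · rw [OPP.point_eq_zero fun h : p.rel i i => hi (h.imp fun _ hS => hS.1)]
    exact ((hb i).resolve_right hi).symm

/-- The vertices of the polytope are the points of the ordered partial partitions. -/
noncomputable def IsFlipMatrix.vertexEquiv (hA : IsFlipMatrix A) :
    OPP n ≃ vertexSet (polytopeF A) :=
  Equiv.ofBijective (fun p => ⟨p.point A, p.point_mem_vertexSet hA⟩)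
    ⟨fun _ _ h => OPP.point_injective hA (congrArg Subtype.val h),
      fun ⟨_, hx⟩ => (hA.exists_point_eq hx).imp fun _ => Subtype.ext⟩

end Vertices

/-! ### Edges -/

section Edges

variable {n : ℕ} {A : Matrix (Fin n) (Fin n) ℝ} {i : Fin n} {p q : OPP n}

/-- If `v` and `w` differ only in the coordinate `i`, which is free strictly between them, then the
sets that are tight inside the segment remain tight at the end `w`, because on the way `i` would
otherwise become active. -/
theorem IsTight.of_segment {v w m : Fin n → ℝ} {S : Finset (Fin n)} (hS : IsTight A m S)
    (hm : m ∈ openSegment ℝ v w) (hvw : ∀ a, a ≠ i → v a = w a)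
    (hfree : ∀ y ∈ openSegment ℝ v w, ¬ IsBlocked A y i) : IsTight A w S := by
  obtain ⟨s, t, hs, ht, hst, rfl⟩ := hm
  have hs' : s = 1 - t := by linarith
  have hoff : ∀ a, a ≠ i → ∀ s t : ℝ, s + t = 1 → (s • v + t • w) a = w a := by
    intro a ha s t hst
    simp only [Pi.add_apply, Pi.smul_apply, smul_eq_mul, hvw a ha]
    rw [← add_mul, hst, one_mul]
  refine ⟨hS.1, fun a ha => ?_⟩
  by_cases hai : a = i
  · subst hai
    by_contra! hlt
    have hle := hS.2 a ha
    simp only [Pi.add_apply, Pi.smul_apply, smul_eq_mul] at hle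
    -- The segment from `w` to the given point crosses the hyperplane where `a` is active.
    have hvw' : w a < v a := by
      by_contra! h
      rw [hs'] at hle hs
      linarith [mul_le_mul_of_nonneg_left h hs.le]
    have hpos : 0 < v a - w a := sub_pos.2 hvw'
    set r := (partialRowSum A S a - w a) / (v a - w a) with hr
    have hrmul : r * (v a - w a) = partialRowSum A S a - w a := div_mul_cancel₀ _ hpos.ne'
    have hr0 : 0 < r := div_pos (sub_pos.2 hlt) hpos
    have hr1 : r < 1 := by
      rw [hr, div_lt_one hpos]
      rw [hs'] at hle
      linarith [mul_lt_mul_of_pos_left hvw' ht]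
    have heq : (r • v + (1 - r) • w) a = partialRowSum A S a := by
      simp only [Pi.add_apply, Pi.smul_apply, smul_eq_mul]
      linarith
    refine hfree (r • v + (1 - r) • w) ⟨r, 1 - r, hr0, by linarith, by ring, rfl⟩
      (Or.inr ⟨S, ⟨hS.1, fun b hb => ?_⟩, ha, heq⟩)
    by_cases hba : b = a
    · exact hba ▸ heq.ge
    · rw [hoff b hba _ _ (by ring), ← hoff b hba s t hst]
      exact hS.2 b hb
  · rw [← hoff a hai s t hst]
    exact hS.2 a ha

/-- The free coordinates inside an edge parallel to `e_i` are exactly `i`. -/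
theorem IsFlipMatrix.isBlocked_iff_of_isEdge (hA : IsFlipMatrix A) {v w y : Fin n → ℝ} {c : ℝ}
    (h : IsEdge (polytopeF A) v w) (hc : w - v = c • (Pi.single i 1 : Fin n → ℝ))
    (hy : y ∈ openSegment ℝ v w) (a : Fin n) : IsBlocked A y a ↔ a ≠ i := by
  obtain ⟨hyF, hdir⟩ := h.2.2.2 y hy
  constructor
  · rintro ha rfl
    have hmem : w - v ∈ faceDirection (polytopeF A) y :=
      hdir ▸ Submodule.mem_span_singleton_self _
    have h0 := (hA.mem_faceDirection_iff hyF _).1 hmem a ha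
    rw [hc] at h0
    have : c = 0 := by simpa using h0
    rw [this, zero_smul, sub_eq_zero] at hc
    exact h.1 hc.symm
  · intro hai
    by_contra ha
    have hmem : (Pi.single a 1 : Fin n → ℝ) ∈ faceDirection (polytopeF A) y := by
      refine (hA.mem_faceDirection_iff hyF _).2 fun b hb => ?_
      exact Pi.single_eq_of_ne (fun hba : b = a => ha (hba ▸ hb)) 1
    rw [hdir, Submodule.mem_span_singleton] at hmem
    obtain ⟨r, hr⟩ := hmem
    have := congrFun hr a
    simp [hc, hai] at this

theorem IsFlipMatrix.exists_parallel_of_isEdge (hA : IsFlipMatrix A) {v w : Fin n → ℝ}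
    (h : IsEdge (polytopeF A) v w) :
    ∃ (i : Fin n) (c : ℝ), w - v = c • (Pi.single i 1 : Fin n → ℝ) := by
  have hy : (1 / 2 : ℝ) • v + (1 / 2 : ℝ) • w ∈ openSegment ℝ v w :=
    ⟨1 / 2, 1 / 2, by norm_num, by norm_num, by norm_num, rfl⟩
  obtain ⟨hyF, hdir⟩ := h.2.2.2 _ hy
  obtain ⟨i, hi⟩ : ∃ i, (w - v) i ≠ 0 := by
    by_contra! hcon
    exact h.1 (sub_eq_zero.1 (funext hcon)).symm
  have hmem : w - v ∈ faceDirection (polytopeF A) ((1 / 2 : ℝ) • v + (1 / 2 : ℝ) • w) :=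
    hdir ▸ Submodule.mem_span_singleton_self _
  have hblocked := (hA.mem_faceDirection_iff hyF _).1 hmem
  have hsingle : (Pi.single i 1 : Fin n → ℝ) ∈
      faceDirection (polytopeF A) ((1 / 2 : ℝ) • v + (1 / 2 : ℝ) • w) := by
    refine (hA.mem_faceDirection_iff hyF _).2 fun b hb => ?_
    exact Pi.single_eq_of_ne (fun hbi : b = i => hi (hbi ▸ hblocked b hb)) 1
  rw [hdir, Submodule.mem_span_singleton] at hsingle
  obtain ⟨r, hr⟩ := hsingle
  have hr0 : r ≠ 0 := by
    rintro rfl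
    simpa using congrFun hr i
  exact ⟨i, r⁻¹, by rw [← hr, smul_smul, inv_mul_cancel₀ hr0, one_smul]⟩

theorem IsFlipMatrix.upperSet_eq_of_isEdge (hA : IsFlipMatrix A) {c : ℝ}
    (h : IsEdge (polytopeF A) (p.point A) (q.point A))
    (hc : q.point A - p.point A = c • (Pi.single i 1 : Fin n → ℝ)) {a : Fin n} (ha : a ≠ i) :
    p.upperSet a = q.upperSet a := by
  have hoff : ∀ a, a ≠ i → p.point A a = q.point A a := fun a ha => by
    have := congrFun hc a
    simp only [Pi.sub_apply, Pi.smul_apply, Pi.single_eq_of_ne ha, smul_zero] at this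
    linarith
  have hfree : ∀ y ∈ openSegment ℝ (p.point A) (q.point A), ¬ IsBlocked A y i := fun y hy hb =>
    (hA.isBlocked_iff_of_isEdge h hc hy i).1 hb rfl
  set m := (1 / 2 : ℝ) • p.point A + (1 / 2 : ℝ) • q.point A with hm_def
  have hm : m ∈ openSegment ℝ (p.point A) (q.point A) :=
    ⟨1 / 2, 1 / 2, by norm_num, by norm_num, by norm_num, rfl⟩
  have hma : m a = q.point A a := by
    simp only [hm_def, Pi.add_apply, Pi.smul_apply, smul_eq_mul, hoff a ha]
    ring
  rcases (hA.isBlocked_iff_of_isEdge h hc hm a).2 ha with h0 | ⟨S, hS⟩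
  · exact OPP.upperSet_eq_of_point_eq_zero hA ((hoff a ha).trans (hma.symm.trans h0))
      (hma.symm.trans h0)
  · have hq : IsActive A (q.point A) S a :=
      ⟨hS.1.of_segment hm hoff hfree, hS.2.1, hma.symm.trans hS.2.2⟩
    have hp : IsActive A (p.point A) S a := by
      refine ⟨hS.1.of_segment (by rwa [openSegment_symm]) (fun b hb => (hoff b hb).symm)
        (by rwa [openSegment_symm]), hS.2.1, ?_⟩
      exact (hoff a ha).trans (hma.symm.trans hS.2.2)
    rw [OPP.upperSet_eq_of_isActive hA hp, OPP.upperSet_eq_of_isActive hA hq]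

/-- Between two vertices whose upper sets agree off `i`, the coordinate `i` is free: if it were
active in a tight set, that set would be tight at the upper end `q`, hence be an upper set of
`q`. -/
theorem IsFlipMatrix.not_isBlocked_of_upperSet_eq (hA : IsFlipMatrix A)
    (h : ∀ a, a ≠ i → p.upperSet a = q.upperSet a) {m : Fin n → ℝ}
    (hoff : ∀ a, a ≠ i → m a = q.point A a) (hp : p.point A i < m i) (hq : m i < q.point A i) :
    ¬ IsBlocked A m i := by
  have hpF := ((hA.mem_polytopeF_iff _).1 (p.point_mem_polytopeF hA)).1 i
  rintro (h0 | ⟨S, hS⟩)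
  · linarith
  have hSq : IsTight A (q.point A) S := by
    refine ⟨hS.1.1, fun b hb => (hS.1.2 b hb).trans ?_⟩
    by_cases hbi : b = i
    · exact hbi ▸ hq.le
    · exact (hoff b hbi).le
  obtain ⟨b, hb⟩ := hSq.exists_isActive hA (q.point_mem_polytopeF hA)
  by_cases hbi : b = i
  · subst hbi
    linarith [hb.2.2, hS.2.2]
  · have hSb := OPP.upperSet_eq_of_isActive hA hb
    rw [← h b hbi] at hSb
    have hbb : p.rel b b := OPP.mem_upperSet.1 (hSb ▸ hb.2.1)
    have := (OPP.isActive_upperSet hA hbb).1.2 i (hSb ▸ hS.2.1)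
    rw [hSb] at this
    linarith [hS.2.2]

theorem IsFlipMatrix.isEdge_of_upperSet_eq (hA : IsFlipMatrix A) (hpq : p ≠ q)
    (h : ∀ a, a ≠ i → p.upperSet a = q.upperSet a) :
    IsEdge (polytopeF A) (p.point A) (q.point A) ∧
      ∃ c : ℝ, q.point A - p.point A = c • (Pi.single i 1 : Fin n → ℝ) := by
  have hne : p.point A ≠ q.point A := (OPP.point_injective hA).ne hpq
  have hoff : ∀ a, a ≠ i → p.point A a = q.point A a := fun a ha => by
    rw [OPP.point_apply, OPP.point_apply, h a ha]
  have hi : p.point A i ≠ q.point A i := fun hi => hne <| funext fun a => by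
    by_cases ha : a = i
    · exact ha ▸ hi
    · exact hoff a ha
  have hc : q.point A - p.point A =
      (q.point A i - p.point A i) • (Pi.single i 1 : Fin n → ℝ) := by
    ext a
    by_cases ha : a = i
    · subst ha
      simp
    · simp [ha, hoff a ha]
  refine ⟨⟨hne, p.point_mem_vertexSet hA, q.point_mem_vertexSet hA, ?_⟩, _, hc⟩
  rintro m ⟨s, t, hs, ht, hst, rfl⟩
  set m := s • p.point A + t • q.point A with hm
  have hmi : m i ∈ openSegment ℝ (p.point A i) (q.point A i) := ⟨s, t, hs, ht, hst, rfl⟩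
  have hmq : ∀ a, a ≠ i → m a = q.point A a := fun a ha => by
    simp only [hm, Pi.add_apply, Pi.smul_apply, smul_eq_mul, hoff a ha]
    rw [← add_mul, hst, one_mul]
  obtain ⟨hp0, hpS⟩ := (hA.mem_polytopeF_iff _).1 (p.point_mem_polytopeF hA)
  obtain ⟨hq0, hqS⟩ := (hA.mem_polytopeF_iff _).1 (q.point_mem_polytopeF hA)
  -- The polytope is a lower set in the orthant, and `m` lies below one of the two ends.
  have hmF : m ∈ polytopeF A := by
    refine (hA.mem_polytopeF_iff _).2 ⟨fun a => ?_, fun S hS => ?_⟩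
    · exact add_nonneg (mul_nonneg hs.le (hp0 a)) (mul_nonneg ht.le (hq0 a))
    · rcases hi.lt_or_gt with hlt | hlt
      · rw [openSegment_eq_Ioo hlt] at hmi
        obtain ⟨a, ha, hle⟩ := hqS S hS
        refine ⟨a, ha, le_trans ?_ hle⟩
        by_cases hai : a = i
        · exact hai ▸ hmi.2.le
        · exact (hmq a hai).le
      · rw [openSegment_symm, openSegment_eq_Ioo hlt] at hmi
        obtain ⟨a, ha, hle⟩ := hpS S hS
        refine ⟨a, ha, le_trans ?_ hle⟩
        by_cases hai : a = i
        · exact hai ▸ hmi.2.le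
        · exact ((hmq a hai).trans (hoff a hai).symm).le
  have hblocked : ∀ a, a ≠ i → IsBlocked A m a := by
    intro a ha
    by_cases haa : q.rel a a
    · have hqa := OPP.isActive_upperSet hA haa
      have hpa := OPP.isActive_upperSet (p := p) hA
        (OPP.mem_upperSet.1 ((h a ha).symm ▸ hqa.2.1))
      refine Or.inr ⟨q.upperSet a, ⟨hqa.1.1, fun b hb => ?_⟩, hqa.2.1,
        (hmq a ha).trans hqa.2.2⟩
      have h1 := hqa.1.2 b hb
      have h2 := hpa.1.2 b ((h a ha).symm ▸ hb)
      rw [h a ha] at h2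
      calc partialRowSum A (q.upperSet a) b
          = s * partialRowSum A (q.upperSet a) b + t * partialRowSum A (q.upperSet a) b := by
            rw [← add_mul, hst, one_mul]
        _ ≤ m b := add_le_add (mul_le_mul_of_nonneg_left h2 hs.le)
            (mul_le_mul_of_nonneg_left h1 ht.le)
    · exact Or.inl ((hmq a ha).trans (OPP.point_eq_zero haa))
  have hfree : ¬ IsBlocked A m i := by
    rcases hi.lt_or_gt with hlt | hlt
    · rw [openSegment_eq_Ioo hlt] at hmi
      exact hA.not_isBlocked_of_upperSet_eq h hmq hmi.1 hmi.2
    · rw [openSegment_symm, openSegment_eq_Ioo hlt] at hmi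
      exact hA.not_isBlocked_of_upperSet_eq (fun a ha => (h a ha).symm)
        (fun a ha => (hmq a ha).trans (hoff a ha).symm) hmi.1 hmi.2
  refine ⟨hmF, ?_⟩
  ext u
  rw [hA.mem_faceDirection_iff hmF, Submodule.mem_span_singleton]
  constructor
  · intro hu
    refine ⟨u i / (q.point A i - p.point A i), ?_⟩
    rw [hc, smul_smul, div_mul_cancel₀ _ (sub_ne_zero.2 hi.symm)]
    ext a
    by_cases ha : a = i
    · subst ha
      simp
    · simp [ha, hu a (hblocked a ha)]
  · rintro ⟨r, rfl⟩ a ha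
    have hai : a ≠ i := fun hai => hfree (hai ▸ ha)
    simp [hoff a hai]

end Edges

/-! ### Flips of ordered partial partitions -/

section Flips

variable {n : ℕ} {z : Fin n} {p q : OPP n}

theorem exists_mem_movePresent_iff {L : List (Finset (Fin n))} (hL : L.head? ≠ some {z})
    (b : Fin n) : (∃ Y ∈ movePresent z L, b ∈ Y) ↔ ∃ Y ∈ L, b ∈ Y := by
  fun_induction movePresent z L with
  | case1 => rfl
  | case2 => simp at hL
  | case3 X h hz =>
    by_cases hb : b = z
    · subst hb; simp [hz]
    · simp [hb]
  | case4 X h hz => rfl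
  | case5 => simp at hL
  | case6 X Y L h hz =>
    by_cases hb : b = z
    · subst hb; simp [hz]
    · simp [hb]
  | case7 X L h hz => simp [or_assoc, or_left_comm]
  | case8 X Y L h hz hY ih =>
    have := ih (by simpa using hY)
    simp only [List.exists_mem_cons_iff] at this ⊢
    rw [this]

/-- Moving `z` changes only the row of `z` in the relation. -/
theorem partsRel_movePresent_iff {L : List (Finset (Fin n))} {a : Fin n} (ha : a ≠ z)
    (b : Fin n) : partsRel (movePresent z L) a b ↔ partsRel L a b := by
  fun_induction movePresent z L with
  | case1 => rfl
  | case2 => simp [partsRel_cons, ha]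
  | case3 X h hz =>
    by_cases hb : b = z
    · subst hb; simp [partsRel_cons, partsRel_nil, ha, hz]
    · simp [partsRel_cons, partsRel_nil, ha, hb]
  | case4 X h hz => rfl
  | case5 => simp [partsRel_cons, ha]
  | case6 X Y L h hz =>
    by_cases hb : b = z
    · subst hb; simp [partsRel_cons, ha, hz]
    · simp [partsRel_cons, ha, hb]
  | case7 X L h hz =>
    simp [partsRel_cons, ha, or_assoc, or_left_comm]
  | case8 X Y L h hz hY ih =>
    rw [partsRel_cons, partsRel_cons X, ih,
      exists_mem_movePresent_iff (by simpa using hY)]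

theorem length_movePresent_ne {L : List (Finset (Fin n))} (hL : ∃ X ∈ L, z ∈ X) :
    (movePresent z L).length ≠ L.length := by
  fun_induction movePresent z L with
  | case1 => simp at hL
  | case2 => simp
  | case3 => simp
  | case4 X h hz => simp [hz] at hL
  | case5 => simp
  | case6 => simp
  | case7 => simp
  | case8 X Y L h hz hY ih =>
    simp only [List.exists_mem_cons_iff, hz, false_or] at hL ih
    simpa using ih hL

theorem OPPTuple.flip_ne (z : Fin n) (t : OPPTuple n) : t.flip z ≠ t := by
  intro h
  have h := congrArg (fun t => t.parts.length) h
  simp only [OPPTuple.flip, flipParts] at h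
  split_ifs at h with hz
  · exact length_movePresent_ne hz h
  · simp at h

theorem OPP.flip_ne (z : Fin n) (p : OPP n) : p.flip z ≠ p := by
  rw [OPP.flip, Ne, ← Equiv.eq_symm_apply]
  exact OPPTuple.flip_ne z _

theorem OPPTuple.flip_rel_iff (t : OPPTuple n) {a : Fin n} (ha : a ≠ z) (b : Fin n) :
    (t.flip z).toOPP.rel a b ↔ t.toOPP.rel a b := by
  change partsRel (flipParts z t.parts) a b ↔ partsRel t.parts a b
  rw [flipParts]
  split_ifs
  · exact partsRel_movePresent_iff ha b
  · simp [partsRel_cons, ha]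

theorem OPP.flip_rel_iff (p : OPP n) {a : Fin n} (ha : a ≠ z) (b : Fin n) :
    (p.flip z).rel a b ↔ p.rel a b := by
  have h := ((OPPTuple.equivOPP n).symm p).flip_rel_iff ha b
  have hp : ((OPPTuple.equivOPP n).symm p).toOPP = p := (OPPTuple.equivOPP n).apply_symm_apply p
  rwa [hp] at h

/-- `{z}` is one of the parts. -/
def OPP.IsSingletonPart (p : OPP n) (z : Fin n) : Prop :=
  p.rel z z ∧ ∀ a, a ≠ z → p.rel a z → ¬ p.rel z a

theorem OPP.rel_of_agree (h : ∀ a, a ≠ z → ∀ b, p.rel a b ↔ q.rel a b)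
    (hz : p.IsSingletonPart z ↔ q.IsSingletonPart z) {b : Fin n} (hb : p.rel z b) :
    q.rel z b := by
  have hzz := (p.weaklyRefl _ _ hb).1
  by_cases hs : p.IsSingletonPart z
  · have hqs := hz.1 hs
    by_cases hbz : b = z
    · exact hbz ▸ hqs.1
    · have hbb := (h b hbz b).1 (p.weaklyRefl _ _ hb).2
      refine (q.weaklyConnected z b hqs.1 hbb).resolve_right fun hbz' => ?_
      exact hs.2 b hbz ((h b hbz z).2 hbz') hb
  · have hqs := mt hz.2 hs
    simp only [IsSingletonPart, not_and, not_forall, not_not] at hs hqs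
    -- `a` and `a'` share the part of `z` in `p` and in `q` respectively.
    obtain ⟨a, ha, haz, hza⟩ := hs hzz
    obtain ⟨a', ha', haz', hza'⟩ := hqs (q.weaklyRefl _ _ ((h a ha z).1 haz)).2
    have h1 : q.rel a' a := (h a' ha' a).1 (p.trans _ _ _ ((h a' ha' z).2 haz') hza)
    have h2 : q.rel a b := (h a ha b).1 (p.trans _ _ _ haz hb)
    exact q.trans _ _ _ hza' (q.trans _ _ _ h1 h2)

/-- Given the rows of the relation other than that of `z`, the relation is determined by whether
`{z}` is a part. -/
theorem OPP.eq_of_agree (h : ∀ a, a ≠ z → ∀ b, p.rel a b ↔ q.rel a b)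
    (hz : p.IsSingletonPart z ↔ q.IsSingletonPart z) : p = q := by
  ext a b
  by_cases ha : a = z
  · subst ha
    exact ⟨rel_of_agree h hz, rel_of_agree (fun a ha b => (h a ha b).symm) hz.symm⟩
  · exact h a ha b

theorem OPP.flip_eq_of_agree (hpq : p ≠ q) (h : ∀ a, a ≠ z → ∀ b, p.rel a b ↔ q.rel a b) :
    p.flip z = q := by
  have h1 : ¬ (p.IsSingletonPart z ↔ q.IsSingletonPart z) := fun hz => hpq (eq_of_agree h hz)
  have h2 : ¬ ((p.flip z).IsSingletonPart z ↔ p.IsSingletonPart z) := fun hz =>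
    p.flip_ne z (eq_of_agree (fun a ha b => p.flip_rel_iff ha b) hz)
  refine eq_of_agree (fun a ha b => (p.flip_rel_iff ha b).trans (h a ha b)) ?_
  tauto

/-- Two ordered partial partitions are swapped by the flip of `z` exactly if they are distinct and
differ only in the row of `z`, because the other rows leave at most two possibilities for
that row. -/
theorem OPP.swapped_iff :
    OPP.Swapped z p q ↔ p ≠ q ∧ ∀ a, a ≠ z → p.upperSet a = q.upperSet a := by
  constructor
  · rintro ⟨rfl, -⟩
    refine ⟨(p.flip_ne z).symm, fun a ha => ?_⟩
    ext b
    rw [mem_upperSet, mem_upperSet, p.flip_rel_iff ha]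
  · rintro ⟨hne, h⟩
    have h' : ∀ a, a ≠ z → ∀ b, p.rel a b ↔ q.rel a b := fun a ha b => by
      rw [← mem_upperSet, h a ha, mem_upperSet]
    exact ⟨flip_eq_of_agree hne h', flip_eq_of_agree hne.symm fun a ha b => (h' a ha b).symm⟩

end Flips

/-! ### The isomorphism -/

theorem IsFlipMatrix.isEdge_parallel_iff_swapped {n : ℕ} {A : Matrix (Fin n) (Fin n) ℝ}
    (hA : IsFlipMatrix A) (i : Fin n) (p q : OPP n) :
    (IsEdge (polytopeF A) (p.point A) (q.point A) ∧
        ∃ c : ℝ, q.point A - p.point A = c • (Pi.single i 1 : Fin n → ℝ)) ↔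
      OPP.Swapped i p q := by
  rw [OPP.swapped_iff]
  constructor
  · rintro ⟨h, c, hc⟩
    exact ⟨fun hpq => h.1 (congrArg _ hpq), fun a ha => hA.upperSet_eq_of_isEdge h hc ha⟩
  · rintro ⟨hne, h⟩
    exact hA.isEdge_of_upperSet_eq hne h

theorem IsFlipMatrix.isEdge_iff_adj {n : ℕ} {A : Matrix (Fin n) (Fin n) ℝ}
    (hA : IsFlipMatrix A) (p q : OPP n) :
    IsEdge (polytopeF A) (p.point A) (q.point A) ↔ (flipGraph n).Adj p q := by
  constructor
  · intro h
    obtain ⟨i, hc⟩ := hA.exists_parallel_of_isEdge h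
    exact ⟨fun hpq => h.1 (congrArg _ hpq), i, (hA.isEdge_parallel_iff_swapped i p q).1 ⟨h, hc⟩⟩
  · rintro ⟨-, i, hi⟩
    exact ((hA.isEdge_parallel_iff_swapped i p q).2 hi).1

theorem proposition4p5 (n : ℕ) (A : Matrix (Fin n) (Fin n) ℝ)
    (ha : ∀ i, 0 < A i i)
    (hb : ∀ i j, i ≠ j → A i j < 0)
    (hc : ∀ i, 0 < ∑ j, A i j) :
    ∃ φ : oneSkeleton (polytopeF A) ≃g flipGraph n,
      (∀ v : vertexSet (polytopeF A), (v : Fin n → ℝ) = OPP.point A (φ v)) ∧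
      ∀ (i : Fin n) (v w : vertexSet (polytopeF A)),
        (IsEdge (polytopeF A) (v : Fin n → ℝ) (w : Fin n → ℝ) ∧
          ∃ c : ℝ, (w : Fin n → ℝ) - (v : Fin n → ℝ) = c • (Pi.single i 1 : Fin n → ℝ)) ↔
        OPP.Swapped i (φ v) (φ w) := by
  have hA : IsFlipMatrix A := ⟨ha, hb, hc⟩
  have hpoint : ∀ v : vertexSet (polytopeF A),
      (v : Fin n → ℝ) = OPP.point A (hA.vertexEquiv.symm v) := fun v =>
    (congrArg Subtype.val (hA.vertexEquiv.apply_symm_apply v)).symm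
  refine ⟨⟨hA.vertexEquiv.symm, @fun v w => ?_⟩, hpoint, fun i v w => ?_⟩
  · change _ ↔ IsEdge (polytopeF A) (v : Fin n → ℝ) (w : Fin n → ℝ)
    rw [hpoint v, hpoint w]
    exact (hA.isEdge_iff_adj _ _).symm
  · rw [hpoint v, hpoint w]
    exact hA.isEdge_parallel_iff_swapped i _ _
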